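/- For a permutation $\pi=\pi_1\pi_2\cdots\pi_n$ of $\{1,\dots,n\}$, let $\mathrm{RLmin}(\pi)$ be the number of right-to-left minima of $\pi$, i.e. of entries $\pi_i$ with $\pi_i<\pi_j$ for all $j=i+1,\dots,n$; let $\mathrm{LRmax}(\pi)$ be the number of left-to-right maxima of $\pi$, i.e. of entries $\pi_i$ with $\pi_i>\pi_j$ for all $j=1,\dots,i-1$; and let $\mathrm{pivot}(\pi)$ be the number of pivots of $\pi$, i.e. of entries $\pi_i$ that are both a left-to-right maximum and a right-to-left minimum. Let $\mathfrak{S}_n$ be the set of all permutations of $\{1,\dots,n\}$. Then for every non-negative integer $n$ the following identity holds in $\mathbb{Z}[X,Y]$ (equivalently, for all elements $X,Y$ of every commutative ring, with the convention $a^0=1$): $$\sum_{\pi\in\mathfrak{S}_n}(X+1)^{\mathrm{RLmin}(\pi)-\mathrm{pivot}(\pi)}(X+Y)^{\mathrm{pivot}(\pi)}Y^{\mathrm{LRmax}(\pi)-\mathrm{pivot}(\pi)}=\sum_{\pi\in\mathfrak{S}_{n+1}}X^{\mathrm{RLmin}(\pi)-1}Y^{\mathrm{LRmax}(\pi)-\mathrm{pivot}(\pi)}.$$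 -/

import Mathlib

namespace PermStat

/-- The set of right-to-left minima of the word `π 0, π 1, …, π (n - 1)`: the values `π i` that are
smaller than all values to their right. (Positions and values are indexed from `0`.) -/
def RLMIN {n : ℕ} (π : Equiv.Perm (Fin n)) : Finset (Fin n) :=
  (Finset.univ.filter fun i => ∀ j, i < j → π i < π j).image π

/-- The set of left-to-right maxima: the values `π i` that are larger than all values to their
left. -/
def LRMAX {n : ℕ} (π : Equiv.Perm (Fin n)) : Finset (Fin n) :=
  (Finset.univ.filter fun i => ∀ j, j < i → π j < π i).image π

/-- The number of right-to-left minima. -/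
def RLmin {n : ℕ} (π : Equiv.Perm (Fin n)) : ℕ := (RLMIN π).card

/-- The number of left-to-right maxima. -/
def LRmax {n : ℕ} (π : Equiv.Perm (Fin n)) : ℕ := (LRMAX π).card

/-- The number of pivots: entries that are both a left-to-right maximum and a right-to-left
minimum. -/
def pivot {n : ℕ} (π : Equiv.Perm (Fin n)) : ℕ := (LRMAX π ∩ RLMIN π).card

/-- The difference `RLmin π - pivot π` is never truncated. -/
theorem pivot_le_RLmin {n : ℕ} (π : Equiv.Perm (Fin n)) : pivot π ≤ RLmin π :=
  Finset.card_le_card Finset.inter_subset_right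

/-- The difference `LRmax π - pivot π` is never truncated. -/
theorem pivot_le_LRmax {n : ℕ} (π : Equiv.Perm (Fin n)) : pivot π ≤ LRmax π :=
  Finset.card_le_card Finset.inter_subset_left

/-- The difference `RLmin π - 1` is never truncated for a permutation of a non-empty set, because
the last entry is a right-to-left minimum. -/
theorem one_le_RLmin {n : ℕ} (π : Equiv.Perm (Fin (n + 1))) : 1 ≤ RLmin π := by
  refine Finset.card_pos.mpr ⟨π (Fin.last n), Finset.mem_image_of_mem _ ?_⟩
  simp only [Finset.mem_filter, Finset.mem_univ, true_and]
  intro j hj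
  exact absurd hj (not_lt.mpr (Fin.le_last j))

end PermStat

namespace PermStat

open Finset Equiv

/-! Expanding the powers of `X + 1` and `X + Y` turns the left side into a sum over pairs `(π, T)`,
where `T` is a set of right-to-left minima of `π` (`weight_eq_sum`). A bijection `shift` sends these
pairs to permutations of size `n + 1`: append a new least entry, then move each entry at `T` or at
the end to the next such position, the new minimum going to the first. The right-to-left minima of
the result are exactly `T` and the end (`rlminPos_eq_of_isMarked`), so `T` is recovered and the
shift can be undone; left-to-right maxima elsewhere do not change (`lrmaxPos_sdiff_eq`). -/

/-- The positions of the right-to-left minima. -/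
def rlminPos {n : ℕ} (π : Perm (Fin n)) : Finset (Fin n) :=
  univ.filter fun i => ∀ j, i < j → π i < π j

/-- The positions of the left-to-right maxima. -/
def lrmaxPos {n : ℕ} (π : Perm (Fin n)) : Finset (Fin n) :=
  univ.filter fun i => ∀ j, j < i → π j < π i

@[simp] theorem mem_rlminPos {n : ℕ} {π : Perm (Fin n)} {i : Fin n} :
    i ∈ rlminPos π ↔ ∀ j, i < j → π i < π j := by simp [rlminPos]

@[simp] theorem mem_lrmaxPos {n : ℕ} {π : Perm (Fin n)} {i : Fin n} :
    i ∈ lrmaxPos π ↔ ∀ j, j < i → π j < π i := by simp [lrmaxPos]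

theorem RLmin_eq_card {n : ℕ} (π : Perm (Fin n)) : RLmin π = #(rlminPos π) :=
  card_image_of_injective _ π.injective

theorem LRmax_eq_card {n : ℕ} (π : Perm (Fin n)) : LRmax π = #(lrmaxPos π) :=
  card_image_of_injective _ π.injective

theorem pivot_eq_card {n : ℕ} (π : Perm (Fin n)) : pivot π = #(lrmaxPos π ∩ rlminPos π) := by
  rw [← card_image_of_injective _ π.injective, image_inter _ _ π.injective]
  rfl

theorem LRmax_sub_pivot {n : ℕ} (π : Perm (Fin n)) :
    LRmax π - pivot π = #(lrmaxPos π \ rlminPos π) := by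
  have := card_sdiff_add_card_inter (lrmaxPos π) (rlminPos π)
  rw [LRmax_eq_card, pivot_eq_card]
  omega

theorem RLmin_sub_pivot {n : ℕ} (π : Perm (Fin n)) :
    RLmin π - pivot π = #(rlminPos π \ lrmaxPos π) := by
  have := card_sdiff_add_card_inter (rlminPos π) (lrmaxPos π)
  rw [RLmin_eq_card, pivot_eq_card, inter_comm]
  omega

/-- Expanding the weight of a permutation over the sets of selected right-to-left minima. -/
theorem weight_eq_sum {R : Type*} [CommRing R] (X Y : R) {n : ℕ} (π : Perm (Fin n)) :
    (X + 1) ^ (RLmin π - pivot π) * (X + Y) ^ pivot π * Y ^ (LRmax π - pivot π) =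
      ∑ T ∈ (rlminPos π).powerset, X ^ #T * Y ^ #(lrmaxPos π \ T) := by
  set A := rlminPos π with hA
  set B := lrmaxPos π with hB
  -- One factor per right-to-left minimum: `X` if selected, otherwise `Y` or `1` according to
  -- whether it is a pivot.
  have h : ∏ i ∈ A, (X + if i ∈ B then Y else 1) =
      (X + 1) ^ (RLmin π - pivot π) * (X + Y) ^ pivot π := by
    rw [RLmin_sub_pivot, pivot_eq_card, ← hA, ← hB, inter_comm B A,
      ← prod_inter_mul_prod_sdiff A B, mul_comm]
    congr 1
    · rw [← prod_const]
      exact prod_congr rfl fun i hi => by rw [if_neg (mem_sdiff.1 hi).2]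
    · rw [← prod_const]
      exact prod_congr rfl fun i hi => by rw [if_pos (mem_inter.1 hi).2]
  rw [← h, prod_add, sum_mul]
  refine sum_congr rfl fun T hT => ?_
  have hT := mem_powerset.1 hT
  rw [prod_const, mul_assoc, prod_ite, prod_const_one, mul_one, prod_const, ← pow_add,
    LRmax_sub_pivot, ← hA, ← hB]
  congr 2
  rw [← card_union_of_disjoint]
  · congr 1
    ext i
    have := @hT i
    simp only [mem_union, mem_filter, mem_sdiff]
    tauto
  · rw [disjoint_left]
    intro i hi
    simp only [mem_filter, mem_sdiff] at hi ⊢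
    tauto

/-! ### Cyclic shifts along a set of positions -/

/-- `c` sends every element of `P` to the next one, the last element `Fin.last n` to the first one,
and fixes everything outside of `P`. -/
structure IsCyclicSucc {n : ℕ} (P : Finset (Fin (n + 1))) (c : Perm (Fin (n + 1))) : Prop where
  apply_of_notMem : ∀ x, x ∉ P → c x = x
  apply_mem : ∀ x ∈ P, c x ∈ P
  apply_last_le : ∀ y ∈ P, c (Fin.last n) ≤ y
  lt_apply : ∀ x ∈ P, x ≠ Fin.last n → x < c x
  apply_le : ∀ x ∈ P, ∀ y ∈ P, x < y → c x ≤ y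

theorem exists_isCyclicSucc {n : ℕ} (P : Finset (Fin (n + 1))) (hP : Fin.last n ∈ P) :
    ∃ c, IsCyclicSucc P c := by
  obtain ⟨m, hm⟩ : ∃ m, #P = m + 1 := Nat.exists_eq_succ_of_ne_zero (card_ne_zero_of_mem hP)
  let e := P.orderIsoOfFin hm
  let c : Perm (Fin (n + 1)) := Perm.ofSubtype (e.toEquiv.permCongr (finRotate (m + 1)))
  have hc : ∀ x (hx : x ∈ P), c x = e (finRotate (m + 1) (e.symm ⟨x, hx⟩)) := fun x hx =>
    Perm.ofSubtype_apply_of_mem _ hx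
  have hl : e.symm ⟨Fin.last n, hP⟩ = Fin.last m := by
    refine le_antisymm (Fin.le_last _) ?_
    rw [OrderIso.le_symm_apply]
    exact Fin.le_last _
  refine ⟨c, fun x hx => Perm.ofSubtype_apply_of_not_mem _ hx, fun x hx => ?_, fun y hy => ?_,
    fun x hx hxl => ?_, fun x hx y hy hxy => ?_⟩
  · rw [hc x hx]
    exact Subtype.prop _
  · rw [hc _ hP, hl, finRotate_last]
    change e 0 ≤ (⟨y, hy⟩ : P)
    rw [← OrderIso.le_symm_apply]
    exact Fin.zero_le _
  · rw [hc x hx]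
    change (⟨x, hx⟩ : P) < e _
    rw [← OrderIso.symm_apply_lt, lt_finRotate_iff_ne_last]
    intro h
    rw [← hl, e.symm.injective.eq_iff] at h
    exact hxl (congrArg Subtype.val h)
  · rw [hc x hx]
    change e _ ≤ (⟨y, hy⟩ : P)
    have h : e.symm ⟨x, hx⟩ < e.symm ⟨y, hy⟩ := e.symm.lt_iff_lt.2 hxy
    rw [← OrderIso.le_symm_apply, Fin.le_def,
      coe_finRotate_of_ne_last (h.trans_le (Fin.le_last _)).ne]
    exact h

namespace IsCyclicSucc

variable {n : ℕ} {P : Finset (Fin (n + 1))} {c : Perm (Fin (n + 1))}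

theorem exists_apply_eq (hc : IsCyclicSucc P c) {x : Fin (n + 1)} (hx : x ∈ P) :
    ∃ y ∈ P, c y = x := by
  refine ⟨c.symm x, ?_, c.apply_symm_apply x⟩
  by_contra h
  have := hc.apply_of_notMem _ h
  rw [c.apply_symm_apply] at this
  exact h (this ▸ hx)

end IsCyclicSucc

/-- The permutations `τ` with least value at the end such that the other positions in `P` are
right-to-left minima of `τ` without its last entry. -/
structure IsMarked {n : ℕ} (P : Finset (Fin (n + 1))) (τ : Perm (Fin (n + 1))) : Prop where
  last_mem : Fin.last n ∈ P
  apply_last : τ (Fin.last n) = 0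
  lt : ∀ p ∈ P, ∀ j, p < j → j ≠ Fin.last n → τ p < τ j

section Cycle

variable {n : ℕ} {P : Finset (Fin (n + 1))} {c σ τ : Perm (Fin (n + 1))}

theorem last_mem_rlminPos (σ : Perm (Fin (n + 1))) : Fin.last n ∈ rlminPos σ :=
  mem_rlminPos.2 fun j hj => absurd hj (not_lt.2 (Fin.le_last j))

/-- The first position of `P` receives the minimum. At a later one, the entry comes from the
preceding position of `P`, so it beats everything to its right and also the unmoved entries between
the two. -/
theorem rlminPos_eq_of_isMarked (hτ : IsMarked P τ) (hc : IsCyclicSucc P c)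
    (hσ : ∀ x, σ (c x) = τ x) : rlminPos σ = P := by
  have hoff : ∀ x, x ∉ P → σ x = τ x := fun x hx => by
    rw [← hσ, hc.apply_of_notMem x hx]
  have hzero : ∀ x, x ≠ c (Fin.last n) → σ (c (Fin.last n)) < σ x := fun x hx => by
    rw [hσ, hτ.apply_last, Fin.pos_iff_ne_zero, ← hτ.apply_last, ← hσ]
    exact fun h => hx (σ.injective h)
  ext x
  rw [mem_rlminPos]
  constructor
  · intro hx
    by_contra hxP
    have hxl : x < Fin.last n :=
      lt_of_le_of_ne (Fin.le_last x) fun h => hxP (h ▸ hτ.last_mem)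
    have hne : (P.filter (x < ·)).Nonempty := ⟨_, mem_filter.2 ⟨hτ.last_mem, hxl⟩⟩
    obtain ⟨hpP, hxp⟩ := mem_filter.1 (min'_mem _ hne)
    set p := (P.filter (x < ·)).min' hne with hp
    obtain ⟨q, hqP, hqp⟩ := hc.exists_apply_eq hpP
    have h := hx p hxp
    rcases eq_or_ne q (Fin.last n) with rfl | hql
    · rw [← hqp] at h
      exact lt_asymm h (hzero x fun h' => hxp.ne (h'.trans hqp))
    · have hqx : q < x := by
        refine lt_of_le_of_ne (not_lt.1 fun hxq => ?_) fun h' => hxP (h' ▸ hqP)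
        have h1 := min'_le (P.filter (x < ·)) q (mem_filter.2 ⟨hqP, hxq⟩)
        have h2 := hc.lt_apply q hqP hql
        rw [hqp] at h2
        exact absurd h1 (not_le.2 h2)
      have := hτ.lt q hqP x hqx hxl.ne
      rw [← hσ, hqp, ← hoff x hxP] at this
      exact lt_asymm h this
  · intro hxP j hj
    obtain ⟨x', hx'P, rfl⟩ := hc.exists_apply_eq hxP
    rcases eq_or_ne x' (Fin.last n) with rfl | hx'l
    · exact hzero j hj.ne'
    have hx' := hc.lt_apply x' hx'P hx'l
    by_cases hjP : j ∈ P
    · obtain ⟨j', hj'P, rfl⟩ := hc.exists_apply_eq hjP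
      have hj'l : j' ≠ Fin.last n := by
        rintro rfl
        exact absurd (hc.apply_last_le _ hxP) (not_le.2 hj)
      rw [hσ, hσ]
      refine hτ.lt x' hx'P j' (lt_of_not_ge fun h => ?_) hj'l
      rcases h.eq_or_lt with rfl | h
      · exact lt_irrefl _ hj
      · exact absurd ((hc.apply_le _ hj'P _ hx'P h).trans hx'.le) (not_le.2 hj)
    · rw [hσ, hoff j hjP]
      exact hτ.lt x' hx'P j (hx'.trans hj) fun h => hjP (h ▸ hτ.last_mem)

theorem isMarked_of_rlminPos_eq (hP : rlminPos σ = P) (hc : IsCyclicSucc P c)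
    (hσ : ∀ x, σ (c x) = τ x) : IsMarked P τ := by
  have hmem : ∀ {x}, x ∈ P → ∀ j, x < j → σ x < σ j := fun {x} hx =>
    mem_rlminPos.1 (hP ▸ hx)
  have hlast : Fin.last n ∈ P := hP ▸ last_mem_rlminPos σ
  have hoff : ∀ x, x ∉ P → σ x = τ x := fun x hx => by
    rw [← hσ, hc.apply_of_notMem x hx]
  refine ⟨hlast, ?_, fun p hpP j hpj hjl => ?_⟩
  · have hz : σ.symm 0 ∈ P := by
      rw [← hP, mem_rlminPos]
      intro j hj
      rw [σ.apply_symm_apply, Fin.pos_iff_ne_zero]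
      exact fun h => hj.ne (σ.symm_apply_eq.2 h.symm)
    rcases (hc.apply_last_le _ hz).eq_or_lt with h | h
    · rw [← hσ, h, σ.apply_symm_apply]
    · have := hmem (hc.apply_mem _ hlast) _ h
      rw [σ.apply_symm_apply] at this
      exact absurd this (Fin.not_lt_zero _)
  · by_cases hjP : j ∈ P
    · rw [← hσ, ← hσ]
      exact hmem (hc.apply_mem p hpP) _
        ((hc.apply_le p hpP j hjP hpj).trans_lt (hc.lt_apply j hjP hjl))
    · rw [← hσ, ← hoff j hjP]
      have hcp := hc.apply_mem p hpP
      -- The smallest entry from `j` on is a right-to-left minimum, so its position is in `P`, at or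
      -- after `c p`.
      obtain ⟨k, hk, hkmin⟩ := exists_min_image (univ.filter (j ≤ ·)) σ ⟨j, by simp⟩
      simp only [mem_filter, mem_univ, true_and] at hk hkmin
      have hkP : k ∈ P := by
        rw [← hP, mem_rlminPos]
        exact fun i hi => lt_of_le_of_ne (hkmin i (hk.trans hi.le)) (σ.injective.ne hi.ne)
      have hle : σ (c p) ≤ σ k := by
        rcases (hc.apply_le p hpP k hkP (hpj.trans_le hk)).eq_or_lt with h | h
        · rw [h]
        · exact (hmem hcp k h).le
      exact lt_of_le_of_ne (hle.trans (hkmin j le_rfl)) (σ.injective.ne fun h => hjP (h ▸ hcp))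

/-- Entries at `P` to the left of `x ∉ P` are smaller than the entry at `x` both before and after
the shift, so they never obstruct. -/
theorem lrmaxPos_sdiff_eq (hτ : IsMarked P τ) (hc : IsCyclicSucc P c)
    (hσ : ∀ x, σ (c x) = τ x) : lrmaxPos σ \ P = lrmaxPos τ \ P := by
  have hP := rlminPos_eq_of_isMarked hτ hc hσ
  have hoff : ∀ x, x ∉ P → σ x = τ x := fun x hx => by
    rw [← hσ, hc.apply_of_notMem x hx]
  ext x
  simp only [mem_sdiff, mem_lrmaxPos]
  refine and_congr_left fun hx => forall₂_congr fun j hj => ?_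
  by_cases hjP : j ∈ P
  · exact iff_of_true (mem_rlminPos.1 (hP ▸ hjP) x hj)
      (hτ.lt j hjP x hj fun h => hx (h ▸ hτ.last_mem))
  · rw [hoff x hx, hoff j hjP]

end Cycle

/-! ### The bijection between pairs and permutations -/

/-- Append a new least entry to a permutation. -/
def appendMin {n : ℕ} (π : Perm (Fin n)) : Perm (Fin (n + 1)) :=
  (finSuccEquivLast.trans π.optionCongr).trans (finSuccEquiv n).symm

@[simp] theorem appendMin_castSucc {n : ℕ} (π : Perm (Fin n)) (i : Fin n) :
    appendMin π i.castSucc = (π i).succ := by simp [appendMin]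

@[simp] theorem appendMin_last {n : ℕ} (π : Perm (Fin n)) : appendMin π (Fin.last n) = 0 := by
  simp [appendMin]

theorem appendMin_injective {n : ℕ} : Function.Injective (appendMin (n := n)) := by
  intro π π' h
  ext i
  have := congrArg (· i.castSucc) h
  simp only [appendMin_castSucc, Fin.succ_inj] at this
  rw [this]

theorem exists_appendMin_eq {n : ℕ} {τ : Perm (Fin (n + 1))} (h : τ (Fin.last n) = 0) :
    ∃ π, appendMin π = τ := by
  let e : Option (Fin n) ≃ Option (Fin n) :=
    (finSuccEquivLast.symm.trans τ).trans (finSuccEquiv n)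
  have he : e none = none := by simp [e, h]
  refine ⟨removeNone e, ?_⟩
  refine Equiv.ext fun x => ?_
  induction x using Fin.lastCases with
  | last => rw [appendMin_last, h]
  | cast i =>
    rw [appendMin_castSucc, ← finSuccEquiv_symm_some, removeNone_some]
    · simp [e]
    · refine Option.ne_none_iff_exists'.1 fun h' => ?_
      exact Option.some_ne_none i (e.injective (h'.trans he.symm))

theorem lrmaxPos_appendMin_castSucc {n : ℕ} {π : Perm (Fin n)} {i : Fin n} :
    i.castSucc ∈ lrmaxPos (appendMin π) ↔ i ∈ lrmaxPos π := by
  simp [Fin.forall_fin_succ', Fin.castSucc_lt_castSucc_iff, (Fin.castSucc_lt_last i).not_gt]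

/-- The positions in `T`, together with a new last position. -/
def insertLast {n : ℕ} (T : Finset (Fin n)) : Finset (Fin (n + 1)) :=
  insert (Fin.last n) (T.map Fin.castSuccEmb)

theorem last_mem_insertLast {n : ℕ} (T : Finset (Fin n)) : Fin.last n ∈ insertLast T :=
  mem_insert_self _ _

@[simp] theorem castSucc_mem_insertLast {n : ℕ} {T : Finset (Fin n)} {i : Fin n} :
    i.castSucc ∈ insertLast T ↔ i ∈ T := by
  simp [insertLast, (Fin.castSucc_lt_last i).ne]

theorem insertLast_injective {n : ℕ} : Function.Injective (insertLast (n := n)) := by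
  intro T T' h
  ext i
  rw [← castSucc_mem_insertLast, h, castSucc_mem_insertLast]

theorem card_insertLast {n : ℕ} (T : Finset (Fin n)) : #(insertLast T) = #T + 1 := by
  rw [insertLast, card_insert_of_notMem, card_map]
  simp [Fin.ext_iff, fun i : Fin n => i.isLt.ne]

theorem exists_insertLast_eq {n : ℕ} {P : Finset (Fin (n + 1))} (h : Fin.last n ∈ P) :
    ∃ T, insertLast T = P := by
  refine ⟨univ.filter (·.castSucc ∈ P), ?_⟩
  ext x
  induction x using Fin.lastCases with
  | last => simp [h, last_mem_insertLast]
  | cast i => simp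

theorem isMarked_appendMin_iff {n : ℕ} {π : Perm (Fin n)} {T : Finset (Fin n)} :
    IsMarked (insertLast T) (appendMin π) ↔ T ⊆ rlminPos π := by
  constructor
  · intro h i hi
    rw [mem_rlminPos]
    intro j hj
    simpa using h.lt i.castSucc (by simpa) j.castSucc (by simpa) (Fin.castSucc_lt_last j).ne
  · intro h
    refine ⟨last_mem_insertLast T, appendMin_last π, fun p hp j hpj hj => ?_⟩
    obtain ⟨j, rfl⟩ := Fin.exists_castSucc_eq.2 hj
    obtain ⟨p, rfl⟩ := Fin.exists_castSucc_eq.2 (hpj.trans_le (Fin.le_last _)).ne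
    simpa using mem_rlminPos.1 (h (by simpa using hp)) j (by simpa using hpj)

/-- Removing the new last position matters only for `n = 0`, where it is a left-to-right maximum. -/
theorem card_lrmaxPos_appendMin_sdiff {n : ℕ} (π : Perm (Fin n)) (T : Finset (Fin n)) :
    #(lrmaxPos (appendMin π) \ insertLast T) = #(lrmaxPos π \ T) := by
  rw [← card_map Fin.castSuccEmb (s := lrmaxPos π \ T)]
  refine congrArg card ?_
  ext x
  induction x using Fin.lastCases with
  | last => simp [last_mem_insertLast, Fin.ext_iff, fun i : Fin n => i.isLt.ne]
  | cast i =>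
    rw [mem_sdiff, lrmaxPos_appendMin_castSucc, castSucc_mem_insertLast, ← mem_sdiff]
    exact (mem_map' Fin.castSuccEmb).symm

/-- The cyclic successor on `insertLast T`. -/
noncomputable def cyc {n : ℕ} (T : Finset (Fin n)) : Perm (Fin (n + 1)) :=
  (exists_isCyclicSucc (insertLast T) (last_mem_insertLast T)).choose

theorem isCyclicSucc_cyc {n : ℕ} (T : Finset (Fin n)) : IsCyclicSucc (insertLast T) (cyc T) :=
  (exists_isCyclicSucc (insertLast T) (last_mem_insertLast T)).choose_spec

/-- Append a new least entry to `π` and shift the entries at `T` and the new one cyclically. -/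
noncomputable def shift {n : ℕ} (π : Perm (Fin n)) (T : Finset (Fin n)) : Perm (Fin (n + 1)) :=
  appendMin π * (cyc T)⁻¹

theorem shift_apply_cyc {n : ℕ} (π : Perm (Fin n)) (T : Finset (Fin n)) (x : Fin (n + 1)) :
    shift π T (cyc T x) = appendMin π x := by simp [shift]

theorem rlminPos_shift {n : ℕ} {π : Perm (Fin n)} {T : Finset (Fin n)} (h : T ⊆ rlminPos π) :
    rlminPos (shift π T) = insertLast T :=
  rlminPos_eq_of_isMarked (isMarked_appendMin_iff.2 h) (isCyclicSucc_cyc T) (shift_apply_cyc π T)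

theorem card_lrmaxPos_shift_sdiff {n : ℕ} {π : Perm (Fin n)} {T : Finset (Fin n)}
    (h : T ⊆ rlminPos π) :
    #(lrmaxPos (shift π T) \ rlminPos (shift π T)) = #(lrmaxPos π \ T) := by
  rw [rlminPos_shift h, lrmaxPos_sdiff_eq (isMarked_appendMin_iff.2 h) (isCyclicSucc_cyc T)
    (shift_apply_cyc π T), card_lrmaxPos_appendMin_sdiff]

theorem exists_shift_eq {n : ℕ} (σ : Perm (Fin (n + 1))) :
    ∃ π T, T ⊆ rlminPos π ∧ shift π T = σ := by
  obtain ⟨T, hT⟩ := exists_insertLast_eq (last_mem_rlminPos σ)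
  have hm : IsMarked (insertLast T) (σ * cyc T) :=
    isMarked_of_rlminPos_eq hT.symm (isCyclicSucc_cyc T) fun _ => rfl
  obtain ⟨π, hπ⟩ := exists_appendMin_eq hm.apply_last
  refine ⟨π, T, isMarked_appendMin_iff.1 (hπ ▸ hm), ?_⟩
  rw [shift, hπ, mul_inv_cancel_right]

theorem shift_injective {n : ℕ} {π π' : Perm (Fin n)} {T T' : Finset (Fin n)}
    (hT : T ⊆ rlminPos π) (hT' : T' ⊆ rlminPos π') (h : shift π T = shift π' T') :
    π = π' ∧ T = T' := by
  obtain rfl : T = T' := insertLast_injective (by rw [← rlminPos_shift hT, h, rlminPos_shift hT'])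
  exact ⟨appendMin_injective (mul_right_cancel h), rfl⟩

end PermStat

/-- The identity holds for all elements `X`, `Y` of every commutative ring; in particular, for the
indeterminates of `ℤ[X, Y]`, it is the identity of polynomials. -/
theorem corollary3p7 {R : Type*} [CommRing R] (X Y : R) (n : ℕ) :
    ∑ π : Equiv.Perm (Fin n),
        (X + 1) ^ (PermStat.RLmin π - PermStat.pivot π) * (X + Y) ^ PermStat.pivot π *
          Y ^ (PermStat.LRmax π - PermStat.pivot π) =
      ∑ π : Equiv.Perm (Fin (n + 1)),
        X ^ (PermStat.RLmin π - 1) * Y ^ (PermStat.LRmax π - PermStat.pivot π) := by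
  classical
  simp_rw [PermStat.weight_eq_sum]
  rw [Finset.sum_sigma']
  refine Finset.sum_bij (fun p _ => PermStat.shift p.1 p.2) (fun _ _ => Finset.mem_univ _)
    ?_ ?_ ?_
  · rintro ⟨π, T⟩ hT ⟨π', T'⟩ hT' h
    simp only [Finset.mem_sigma, Finset.mem_univ, Finset.mem_powerset, true_and] at hT hT'
    obtain ⟨rfl, rfl⟩ := PermStat.shift_injective hT hT' h
    rfl
  · intro σ _
    obtain ⟨π, T, hT, h⟩ := PermStat.exists_shift_eq σ
    exact ⟨⟨π, T⟩, by simpa using hT, h⟩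
  · rintro ⟨π, T⟩ hT
    simp only [Finset.mem_sigma, Finset.mem_univ, Finset.mem_powerset, true_and] at hT
    -- The `- 1` in the exponent of `X` discounts the last position, leaving `#T`.
    rw [PermStat.RLmin_eq_card, PermStat.LRmax_sub_pivot, PermStat.card_lrmaxPos_shift_sdiff hT,
      PermStat.rlminPos_shift hT, PermStat.card_insertLast, Nat.add_sub_cancel]
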